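/- Let $m\ge 1$ be an integer, let $\lambda_1,\dots,\lambda_{m-1}\in\mathbb{R}^2$ and $R_1,\dots,R_{m-1}\in\mathbb{R}$, and define polynomials in $\mathbb{R}[x_1,x_2]$ by $$g_0(x)=1-|x|^2,\qquad g_i(x)=|x-\lambda_i|^2-R_i^2,\quad i=1,\dots,m-1,$$ where $x=(x_1,x_2)$ and $|x|^2=x_1^2+x_2^2$. Suppose that the set $$S=\{x\in\mathbb{R}^2 : g_i(x)\ge 0,\ i=0,\dots,m-1\}$$ (the closed unit disk with the open disks of centres $\lambda_i$ and radii $|R_i|$ removed) is nonempty. If $p\in\mathbb{R}[x_1,x_2]$ satisfies $p(x)>0$ for all $x\in S$, then there exist an integer $N\ge 0$ and polynomials $r_j,r_{ij}\in\mathbb{R}[x_1,x_2]$, $i=0,\dots,m-1$, $j=0,\dots,N$, such that $$p=\sum_{j=0}^N r_j^2+\sum_{i=0}^{m-1}\Bigl(\sum_{j=0}^N r_{ij}^2\Bigr)g_i .$$ -/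

import Mathlib

open MvPolynomial

noncomputable section

/-- The polynomial `1 - |x|²` in `ℝ[x₁, x₂]`. -/
def unitDiskPoly : MvPolynomial (Fin 2) ℝ :=
  1 - (X 0 ^ 2 + X 1 ^ 2)

/-- The polynomial `|x - c|² - ρ²` in `ℝ[x₁, x₂]`, where `c ∈ ℝ²` and `ρ ∈ ℝ`. -/
def holePoly (c : Fin 2 → ℝ) (ρ : ℝ) : MvPolynomial (Fin 2) ℝ :=
  (X 0 - C (c 0)) ^ 2 + (X 1 - C (c 1)) ^ 2 - C (ρ ^ 2)

/-- The family `g₀ = 1 - |x|²`, `g_{i+1} = |x - c i|² - (ρ i)²` for `i < h`, where `h` is the number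
of holes. -/
def holedDiskPolys {h : ℕ} (c : Fin h → Fin 2 → ℝ) (ρ : Fin h → ℝ) :
    Fin (h + 1) → MvPolynomial (Fin 2) ℝ :=
  Fin.cons unitDiskPoly fun i => holePoly (c i) (ρ i)

/-- The set of points of `ℝⁿ` at which all the polynomials of the family `g` are nonnegative. -/
def nonnegSet {n m : ℕ} (g : Fin m → MvPolynomial (Fin n) ℝ) : Set (Fin n → ℝ) :=
  {x | ∀ i, 0 ≤ eval x (g i)}

end

/-! The polynomials of the asserted form are the quadratic module `M` generated by the `g i`. Since
`1 - |x|²` lies in `M`, so does each `1 - X i ^ 2`, which makes `M` Archimedean; the holes play no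
part in this. If `-1 = m - s * p` with `m ∈ M` and `s` a sum of squares, then `s * p - 1 ∈ M`, and a
descent on constants gives `p ∈ M` (`mem_of_sumSq_mul_sub_one_mem`). Otherwise `M` with `-p`
adjoined is proper and extends to a maximal proper `P`. Maximality gives `P ∪ -P = A`, so each
element has a unique real value modulo `P`, and taking values is a character
(`exists_algHom_of_maximal`). On polynomials it is evaluation at a point of `S` where `p ≤ 0`,
contradicting positivity. -/

section QuadraticModule

/-! ### Quadratic modules and maximal proper ones -/

variable {A : Type*} [CommRing A]

/-- A quadratic module of a commutative ring: a subset containing `1`, closed under addition and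
under multiplication by squares. -/
structure IsQuadraticModule (M : Set A) : Prop where
  one_mem : 1 ∈ M
  add_mem : ∀ {a b}, a ∈ M → b ∈ M → a + b ∈ M
  sq_mul_mem : ∀ (a) {b}, b ∈ M → a ^ 2 * b ∈ M

namespace IsQuadraticModule

variable {M : Set A}

theorem zero_mem (hM : IsQuadraticModule M) : (0 : A) ∈ M := by
  simpa using hM.sq_mul_mem 0 hM.one_mem

theorem sumSq_mul_mem (hM : IsQuadraticModule M) {s b : A} (hs : IsSumSq s) (hb : b ∈ M) :
    s * b ∈ M := by
  induction hs with
  | zero => simpa using hM.zero_mem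
  | sq_add a _ ih =>
    rw [add_mul, ← pow_two]
    exact hM.add_mem (hM.sq_mul_mem a hb) ih

theorem sumSq_mem (hM : IsQuadraticModule M) {s : A} (hs : IsSumSq s) : s ∈ M := by
  simpa using hM.sumSq_mul_mem hs hM.one_mem

/-- Adjoining one element to a quadratic module. -/
theorem adjoin (hM : IsQuadraticModule M) (f : A) :
    IsQuadraticModule {a | ∃ m ∈ M, ∃ s, IsSumSq s ∧ a = m + s * f} where
  one_mem := ⟨1, hM.one_mem, 0, .zero, by ring⟩
  add_mem := by
    rintro _ _ ⟨m, hm, s, hs, rfl⟩ ⟨m', hm', s', hs', rfl⟩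
    exact ⟨m + m', hM.add_mem hm hm', s + s', hs.add hs', by ring⟩
  sq_mul_mem := by
    rintro a _ ⟨m, hm, s, hs, rfl⟩
    exact ⟨a ^ 2 * m, hM.sq_mul_mem a hm, a ^ 2 * s,
      (IsSquare.isSumSq ⟨a, pow_two a⟩).mul hs, by ring⟩

theorem subset_adjoin (f : A) :
    M ⊆ {a | ∃ m ∈ M, ∃ s, IsSumSq s ∧ a = m + s * f} :=
  fun m hm => ⟨m, hm, 0, .zero, by ring⟩

theorem self_mem_adjoin (hM : IsQuadraticModule M) (f : A) :
    f ∈ {a | ∃ m ∈ M, ∃ s, IsSumSq s ∧ a = m + s * f} :=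
  ⟨0, hM.zero_mem, 1, IsSquare.isSumSq ⟨1, by ring⟩, by ring⟩

/-- Every proper quadratic module is contained in a maximal proper one. -/
theorem exists_maximal (hM : IsQuadraticModule M) (h : (-1 : A) ∉ M) :
    ∃ P, M ⊆ P ∧ Maximal (fun Q : Set A => IsQuadraticModule Q ∧ (-1 : A) ∉ Q) P := by
  refine zorn_subset_nonempty {Q : Set A | IsQuadraticModule Q ∧ (-1 : A) ∉ Q} ?_ M ⟨hM, h⟩
  intro c hc hchain hne
  refine ⟨⋃₀ c, ⟨⟨?_, ?_, ?_⟩, ?_⟩, fun s hs => Set.subset_sUnion_of_mem hs⟩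
  · obtain ⟨Q, hQ⟩ := hne
    exact ⟨Q, hQ, (hc hQ).1.one_mem⟩
  · rintro a b ⟨Q, hQ, ha⟩ ⟨R, hR, hb⟩
    rcases hchain.total hQ hR with hle | hle
    · exact ⟨R, hR, (hc hR).1.add_mem (hle ha) hb⟩
    · exact ⟨Q, hQ, (hc hQ).1.add_mem ha (hle hb)⟩
  · rintro a b ⟨Q, hQ, hb⟩
    exact ⟨Q, hQ, (hc hQ).1.sq_mul_mem a hb⟩
  · rintro ⟨Q, hQ, hn⟩
    exact (hc hQ).2 hn

variable [Algebra ℝ A]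

theorem algebraMap_mul_mem (hM : IsQuadraticModule M) {r : ℝ} (hr : 0 ≤ r) {f : A} (hf : f ∈ M) :
    algebraMap ℝ A r * f ∈ M := by
  have := hM.sq_mul_mem (algebraMap ℝ A √r) hf
  rwa [← map_pow, Real.sq_sqrt hr] at this

theorem algebraMap_mem (hM : IsQuadraticModule M) {r : ℝ} (hr : 0 ≤ r) : algebraMap ℝ A r ∈ M := by
  simpa using hM.algebraMap_mul_mem hr hM.one_mem

theorem mem_of_algebraMap_mul_mem (hM : IsQuadraticModule M) {r : ℝ} (hr : 0 < r) {f : A}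
    (hf : algebraMap ℝ A r * f ∈ M) : f ∈ M := by
  have := hM.algebraMap_mul_mem (inv_nonneg.2 hr.le) hf
  rwa [← mul_assoc, ← map_mul, inv_mul_cancel₀ hr.ne', map_one, one_mul] at this

theorem algebraMap_sub_mem_of_le (hM : IsQuadraticModule M) {r s : ℝ} (h : r ≤ s) {f : A}
    (hf : algebraMap ℝ A r - f ∈ M) : algebraMap ℝ A s - f ∈ M := by
  have := hM.add_mem hf (hM.algebraMap_mem (sub_nonneg.2 h))
  rw [map_sub] at this
  convert this using 1
  ring

theorem nonneg_of_algebraMap_mem (hM : IsQuadraticModule M) (h : (-1 : A) ∉ M) {r : ℝ}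
    (hr : algebraMap ℝ A r ∈ M) : 0 ≤ r := by
  by_contra! hneg
  refine h (hM.mem_of_algebraMap_mul_mem (neg_pos.2 hneg) ?_)
  simpa using hr

/-- The support `M ∩ -M` of a quadratic module is closed under multiplication. -/
theorem mul_mem_of_mem_of_neg_mem (hM : IsQuadraticModule M) {a : A} (ha : a ∈ M) (hna : -a ∈ M)
    (f : A) : f * a ∈ M := by
  refine hM.mem_of_algebraMap_mul_mem (r := 4) (by norm_num) ?_
  -- Polarization: `4fa = (f + 1)²a + (f - 1)²(-a)`.
  have := hM.add_mem (hM.sq_mul_mem (f + 1) ha) (hM.sq_mul_mem (f - 1) hna)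
  convert this using 1
  rw [map_ofNat]
  ring

/-- A maximal proper quadratic module `M` satisfies `M ∪ -M = A`. -/
theorem mem_or_neg_mem_of_maximal
    (hM : Maximal (fun Q : Set A => IsQuadraticModule Q ∧ (-1 : A) ∉ Q) M) (f : A) :
    f ∈ M ∨ -f ∈ M := by
  have hQ := hM.prop.1
  have key : ∀ g ∉ M, ∃ m ∈ M, ∃ s, IsSumSq s ∧ -1 = m + s * g := by
    intro g hg
    by_contra hcon
    exact hg (hM.le_of_ge ⟨hQ.adjoin g, hcon⟩ (subset_adjoin g) (hQ.self_mem_adjoin g))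
  by_contra! hcon
  obtain ⟨m, hm, s, hs, h1⟩ := key f hcon.1
  obtain ⟨m', hm', s', hs', h2⟩ := key (-f) hcon.2
  -- Eliminating `f` between `h1` and `h2` gives `-s = s'm + sm' + s'`. Hence `s` is in the support,
  -- so `s * f ∈ M` and `-1 = m + s * f ∈ M`.
  have hsum : -s ∈ M := by
    have := hQ.add_mem (hQ.add_mem (hQ.sumSq_mul_mem hs' hm) (hQ.sumSq_mul_mem hs hm'))
      (hQ.sumSq_mem hs')
    convert this using 1
    linear_combination s' * h1 + s * h2
  refine hM.prop.2 ?_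
  rw [h1, mul_comm]
  exact hQ.add_mem hm (hQ.mul_mem_of_mem_of_neg_mem (hQ.sumSq_mem hs) hsum f)

/-- `M` need not be closed under products, but `(r - f)²(r + f) + (r + f)²(r - f) = 2r(r² - f²)`. -/
theorem sq_sub_sq_mem (hM : IsQuadraticModule M) {r : ℝ} (hr : 0 < r) {f : A}
    (h₁ : algebraMap ℝ A r - f ∈ M) (h₂ : algebraMap ℝ A r + f ∈ M) :
    algebraMap ℝ A (r ^ 2) - f ^ 2 ∈ M := by
  refine hM.mem_of_algebraMap_mul_mem (r := 2 * r) (by positivity) ?_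
  have := hM.add_mem (hM.sq_mul_mem (algebraMap ℝ A r - f) h₂)
    (hM.sq_mul_mem (algebraMap ℝ A r + f) h₁)
  convert this using 1
  rw [map_mul, map_pow, map_ofNat]
  ring

/-! ### Real values modulo a quadratic module -/

/-- The element `f` has value `r` with respect to the quadratic module `M`. -/
def HasValue (M : Set A) (f : A) (r : ℝ) : Prop :=
  ∀ ε : ℝ, 0 < ε → algebraMap ℝ A ε + (f - algebraMap ℝ A r) ∈ M ∧
    algebraMap ℝ A ε - (f - algebraMap ℝ A r) ∈ M

theorem HasValue.le_of_sub_mem (hM : IsQuadraticModule M) (h : (-1 : A) ∉ M) {f g : A} {r s : ℝ}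
    (hf : HasValue M f r) (hg : HasValue M g s) (hfg : g - f ∈ M) : r ≤ s := by
  refine le_of_forall_pos_le_add fun ε hε => ?_
  have := hM.add_mem (hM.add_mem (hf (ε / 2) (half_pos hε)).1 (hg (ε / 2) (half_pos hε)).2) hfg
  suffices 0 ≤ s + ε - r by linarith
  refine hM.nonneg_of_algebraMap_mem h ?_
  convert this using 1
  rw [show s + ε - r = ε / 2 + ε / 2 + s - r by ring, map_sub, map_add, map_add]
  ring

theorem HasValue.unique (hM : IsQuadraticModule M) (h : (-1 : A) ∉ M) {f : A} {r s : ℝ}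
    (hr : HasValue M f r) (hs : HasValue M f s) : r = s :=
  le_antisymm (hr.le_of_sub_mem hM h hs (by simpa using hM.zero_mem))
    (hs.le_of_sub_mem hM h hr (by simpa using hM.zero_mem))

theorem hasValue_algebraMap (hM : IsQuadraticModule M) (r : ℝ) :
    HasValue M (algebraMap ℝ A r) r := fun ε hε => by
  simpa using hM.algebraMap_mem hε.le

theorem HasValue.add (hM : IsQuadraticModule M) {f g : A} {r s : ℝ}
    (hf : HasValue M f r) (hg : HasValue M g s) : HasValue M (f + g) (r + s) := by
  intro ε hε
  have hsplit : algebraMap ℝ A ε = algebraMap ℝ A (ε / 2) + algebraMap ℝ A (ε / 2) := by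
    rw [← map_add, add_halves]
  have h₁ := hf _ (half_pos hε)
  have h₂ := hg _ (half_pos hε)
  constructor
  · convert hM.add_mem h₁.1 h₂.1 using 1
    rw [hsplit, map_add]
    ring
  · convert hM.add_mem h₁.2 h₂.2 using 1
    rw [hsplit, map_add]
    ring

theorem HasValue.neg {f : A} {r : ℝ} (hf : HasValue M f r) : HasValue M (-f) (-r) := by
  intro ε hε
  have h := hf ε hε
  constructor
  · convert h.2 using 1
    rw [map_neg]
    ring
  · convert h.1 using 1
    rw [map_neg]
    ring

theorem HasValue.algebraMap_mul_of_pos (hM : IsQuadraticModule M) {f : A} {r c : ℝ} (hc : 0 < c)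
    (hf : HasValue M f r) : HasValue M (algebraMap ℝ A c * f) (c * r) := by
  intro ε hε
  have h := hf (ε / c) (div_pos hε hc)
  have hsplit : algebraMap ℝ A ε = algebraMap ℝ A c * algebraMap ℝ A (ε / c) := by
    rw [← map_mul, mul_div_cancel₀ _ hc.ne']
  constructor
  · convert hM.algebraMap_mul_mem hc.le h.1 using 1
    rw [hsplit, map_mul]
    ring
  · convert hM.algebraMap_mul_mem hc.le h.2 using 1
    rw [hsplit, map_mul]
    ring

theorem HasValue.algebraMap_mul (hM : IsQuadraticModule M) {f : A} {r : ℝ} (c : ℝ)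
    (hf : HasValue M f r) : HasValue M (algebraMap ℝ A c * f) (c * r) := by
  rcases lt_trichotomy c 0 with hc | rfl | hc
  · simpa using hf.neg.algebraMap_mul_of_pos hM (neg_pos.2 hc)
  · simpa using hasValue_algebraMap hM 0
  · exact hf.algebraMap_mul_of_pos hM hc

theorem HasValue.sq_zero (hM : IsQuadraticModule M) {f : A} (hf : HasValue M f 0) :
    HasValue M (f ^ 2) 0 := by
  intro ε hε
  have h := hf √ε (Real.sqrt_pos.2 hε)
  simp only [map_zero, sub_zero] at h ⊢
  refine ⟨hM.add_mem (hM.algebraMap_mem hε.le)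
    (by simpa using hM.sq_mul_mem f hM.one_mem), ?_⟩
  simpa [Real.sq_sqrt hε.le] using hM.sq_sub_sq_mem (Real.sqrt_pos.2 hε) h.2 h.1

theorem HasValue.sq (hM : IsQuadraticModule M) {f : A} {r : ℝ} (hf : HasValue M f r) :
    HasValue M (f ^ 2) (r ^ 2) := by
  have h₀ : HasValue M (f + algebraMap ℝ A (-r)) 0 := by
    simpa using hf.add hM (hasValue_algebraMap hM (-r))
  have h := ((h₀.sq_zero hM).add hM (hf.algebraMap_mul hM (2 * r))).add hM
    (hasValue_algebraMap hM (-r ^ 2))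
  convert h using 1
  · simp only [map_mul, map_neg, map_pow, map_ofNat]
    ring
  · ring

/-- Squares suffice, by `4fg = (f + g)² - (f - g)²`. -/
theorem HasValue.mul (hM : IsQuadraticModule M) {f g : A} {r s : ℝ}
    (hf : HasValue M f r) (hg : HasValue M g s) : HasValue M (f * g) (r * s) := by
  have h := (((hf.add hM hg).sq hM).add hM ((hf.add hM hg.neg).sq hM).neg).algebraMap_mul hM (1 / 4)
  convert h using 1
  · have h4 : algebraMap ℝ A (1 / 4) * 4 = 1 := by
      rw [← map_ofNat (algebraMap ℝ A) 4, ← map_mul]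
      norm_num
    linear_combination (-f * g) * h4
  · ring

/-- A quadratic module of a real algebra is Archimedean if each element is bounded above by a
constant with respect to it. -/
def IsArchimedean (M : Set A) : Prop :=
  ∀ f : A, ∃ r : ℝ, algebraMap ℝ A r - f ∈ M

/-- The value is the Dedekind cut `sup {r | f - r ∈ M}`: the Archimedean property makes the set
nonempty and bounded, and totality supplies the upper estimate. -/
theorem exists_hasValue (hM : IsQuadraticModule M) (h : (-1 : A) ∉ M) (harch : IsArchimedean M)
    (htot : ∀ f, f ∈ M ∨ -f ∈ M) (f : A) : ∃ r, HasValue M f r := by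
  set T : Set ℝ := {r | f - algebraMap ℝ A r ∈ M} with hT
  have hne : T.Nonempty := by
    obtain ⟨r, hr⟩ := harch (-f)
    refine ⟨-r, ?_⟩
    simpa [hT, add_comm] using hr
  have hbdd : BddAbove T := by
    obtain ⟨s, hs⟩ := harch f
    refine ⟨s, fun r hr => ?_⟩
    have := hM.add_mem hs hr
    rw [sub_add_sub_cancel, ← map_sub] at this
    exact sub_nonneg.1 (hM.nonneg_of_algebraMap_mem h this)
  refine ⟨sSup T, fun ε hε => ⟨?_, ?_⟩⟩
  · obtain ⟨r, hr, hlt⟩ := exists_lt_of_lt_csSup hne (sub_lt_self (sSup T) hε)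
    have := hM.add_mem hr (hM.algebraMap_mem (r := r - (sSup T - ε)) (by linarith))
    convert this using 1
    simp only [map_sub]
    ring
  · have hnot : f - algebraMap ℝ A (sSup T + ε) ∉ M := fun hmem => by
      have := le_csSup hbdd (show sSup T + ε ∈ T from hmem)
      linarith
    convert (htot _).resolve_left hnot using 1
    rw [map_add]
    ring

/-- A maximal proper quadratic module that is Archimedean is nonnegative under some
real-valued character. -/
theorem exists_algHom_of_maximal
    (hM : Maximal (fun Q : Set A => IsQuadraticModule Q ∧ (-1 : A) ∉ Q) M)
    (harch : IsArchimedean M) : ∃ φ : A →ₐ[ℝ] ℝ, ∀ f ∈ M, 0 ≤ φ f := by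
  obtain ⟨hQ, hn⟩ := hM.prop
  choose v hv using exists_hasValue hQ hn harch (mem_or_neg_mem_of_maximal hM)
  have hC (r : ℝ) : v (algebraMap ℝ A r) = r := (hv _).unique hQ hn (hasValue_algebraMap hQ r)
  refine ⟨{ toFun := v
            map_one' := by simpa using hC 1
            map_zero' := by simpa using hC 0
            map_mul' := fun f g => (hv _).unique hQ hn ((hv f).mul hQ (hv g))
            map_add' := fun f g => (hv _).unique hQ hn ((hv f).add hQ (hv g))
            commutes' := hC }, fun f hf => ?_⟩
  refine HasValue.le_of_sub_mem hQ hn (f := 0) (g := f) ?_ (hv f) (by simpa using hf)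
  simpa using hasValue_algebraMap hQ 0

/-! ### From characters to membership -/

theorem IsArchimedean.mono {N : Set A} (hM : IsArchimedean M) (h : M ⊆ N) : IsArchimedean N :=
  fun f => (hM f).imp fun _ hr => h hr

/-- If `s * p - 1` lies in an Archimedean quadratic module for some sum of squares `s`, then so
does `p`. -/
theorem mem_of_sumSq_mul_sub_one_mem (hM : IsQuadraticModule M) (harch : IsArchimedean M)
    {s p : A} (hs : IsSumSq s) (h : s * p - 1 ∈ M) : p ∈ M := by
  obtain ⟨k, hk, hk₁, hk₂⟩ : ∃ k : ℝ, 0 < k ∧ algebraMap ℝ A (2 * k) - s ∈ M ∧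
      algebraMap ℝ A (2 * k) - (s * (s * p) + 1) ∈ M := by
    obtain ⟨a, ha⟩ := harch s
    obtain ⟨b, hb⟩ := harch (s * (s * p) + 1)
    refine ⟨max 1 (max a b), by positivity, hM.algebraMap_sub_mem_of_le ?_ ha,
      hM.algebraMap_sub_mem_of_le ?_ hb⟩
    all_goals
      linarith [le_max_left (1 : ℝ) (max a b), le_max_right (1 : ℝ) (max a b), le_max_left a b,
        le_max_right a b]
  -- The constant drops by a fixed amount, because `k²(p + r) - 1 = (k - s)²(p + r) + 2k(sp - 1) +
  -- (2k - s²p - 1) + rs(2k - s)`.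
  have step : ∀ r : ℝ, 0 ≤ r → p + algebraMap ℝ A r ∈ M →
      p + algebraMap ℝ A (r - 1 / k ^ 2) ∈ M := by
    intro r hr hpr
    refine hM.mem_of_algebraMap_mul_mem (r := k ^ 2) (by positivity) ?_
    have := hM.add_mem (hM.add_mem (hM.sq_mul_mem (algebraMap ℝ A k - s) hpr)
      (hM.algebraMap_mul_mem (r := 2 * k) (by positivity) h))
      (hM.add_mem hk₂ (hM.algebraMap_mul_mem hr (hM.sumSq_mul_mem hs hk₁)))
    convert this using 1
    have hinv : algebraMap ℝ A k ^ 2 * algebraMap ℝ A (1 / k ^ 2) = 1 := by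
      rw [← map_pow, ← map_mul, mul_one_div_cancel (by positivity), map_one]
    simp only [map_sub, map_mul, map_pow, map_ofNat]
    linear_combination -hinv
  have descent : ∀ n : ℕ, ∀ r : ℝ, r ≤ n * (1 / k ^ 2) → p + algebraMap ℝ A r ∈ M → p ∈ M := by
    have base : ∀ r : ℝ, r ≤ 0 → p + algebraMap ℝ A r ∈ M → p ∈ M := fun r hr hpr => by
      simpa using hM.add_mem hpr (hM.algebraMap_mem (neg_nonneg.2 hr))
    intro n
    induction n with
    | zero => exact fun r hr => base r (by simpa using hr)
    | succ n ih =>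
      intro r hr hpr
      rcases le_total r 0 with h0 | h0
      · exact base r h0 hpr
      · refine ih _ ?_ (step r h0 hpr)
        push_cast at hr
        linarith
  obtain ⟨r, hr⟩ := harch (-p)
  obtain ⟨n, hn⟩ := exists_nat_ge (r / (1 / k ^ 2))
  refine descent n r ((div_le_iff₀ (by positivity)).1 hn) ?_
  simpa [add_comm] using hr

/-- **Jacobi–Putinar representation theorem**: an element of a real algebra that is positive under
all characters that are nonnegative on an Archimedean quadratic module belongs to that module. -/
theorem mem_of_forall_algHom_pos (hM : IsQuadraticModule M) (harch : IsArchimedean M) {p : A}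
    (hp : ∀ φ : A →ₐ[ℝ] ℝ, (∀ f ∈ M, 0 ≤ φ f) → 0 < φ p) : p ∈ M := by
  by_cases hproper : (-1 : A) ∈ {a | ∃ m ∈ M, ∃ s, IsSumSq s ∧ a = m + s * -p}
  · obtain ⟨m, hm, s, hs, h⟩ := hproper
    refine hM.mem_of_sumSq_mul_sub_one_mem harch hs ?_
    convert hm using 1
    linear_combination h
  · obtain ⟨P, hle, hP⟩ := (hM.adjoin (-p)).exists_maximal hproper
    have hMP := (subset_adjoin (-p)).trans hle
    obtain ⟨φ, hφ⟩ := exists_algHom_of_maximal hP (harch.mono hMP)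
    have h₁ := hp φ fun f hf => hφ f (hMP hf)
    have h₂ := hφ _ (hle (hM.self_mem_adjoin (-p)))
    rw [map_neg] at h₂
    linarith

/-! ### Bounded elements and the Archimedean property -/

/-- `f` is bounded with respect to the quadratic module `M`. -/
def IsBddElem (M : Set A) (f : A) : Prop :=
  ∃ r : ℝ, 0 < r ∧ algebraMap ℝ A r - f ∈ M ∧ algebraMap ℝ A r + f ∈ M

theorem isBddElem_algebraMap (hM : IsQuadraticModule M) (c : ℝ) :
    IsBddElem M (algebraMap ℝ A c) := by
  refine ⟨|c| + 1, by positivity, ?_, ?_⟩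
  · rw [← map_sub]
    exact hM.algebraMap_mem (by linarith [le_abs_self c])
  · rw [← map_add]
    exact hM.algebraMap_mem (by linarith [neg_abs_le c])

theorem IsBddElem.add (hM : IsQuadraticModule M) {f g : A} (hf : IsBddElem M f)
    (hg : IsBddElem M g) : IsBddElem M (f + g) := by
  obtain ⟨r, hr, h₁, h₂⟩ := hf
  obtain ⟨s, hs, h₃, h₄⟩ := hg
  refine ⟨r + s, by positivity, ?_, ?_⟩
  · convert hM.add_mem h₁ h₃ using 1
    rw [map_add]
    ring
  · convert hM.add_mem h₂ h₄ using 1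
    rw [map_add]
    ring

theorem IsBddElem.neg {f : A} (hf : IsBddElem M f) : IsBddElem M (-f) := by
  obtain ⟨r, hr, h₁, h₂⟩ := hf
  exact ⟨r, hr, by simpa using h₂, by simpa [sub_eq_add_neg] using h₁⟩

theorem IsBddElem.sq (hM : IsQuadraticModule M) {f : A} (hf : IsBddElem M f) :
    IsBddElem M (f ^ 2) := by
  obtain ⟨r, hr, h₁, h₂⟩ := hf
  refine ⟨r ^ 2, by positivity, hM.sq_sub_sq_mem hr h₁ h₂,
    hM.add_mem (hM.algebraMap_mem (by positivity)) ?_⟩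
  simpa using hM.sq_mul_mem f hM.one_mem

theorem IsBddElem.of_algebraMap_mul (hM : IsQuadraticModule M) {c : ℝ} (hc : 0 < c) {f : A}
    (hf : IsBddElem M (algebraMap ℝ A c * f)) : IsBddElem M f := by
  obtain ⟨r, hr, h₁, h₂⟩ := hf
  have hsplit : algebraMap ℝ A r = algebraMap ℝ A c * algebraMap ℝ A (r / c) := by
    rw [← map_mul, mul_div_cancel₀ _ hc.ne']
  rw [hsplit, ← mul_sub] at h₁
  rw [hsplit, ← mul_add] at h₂
  exact ⟨r / c, by positivity, hM.mem_of_algebraMap_mul_mem hc h₁,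
    hM.mem_of_algebraMap_mul_mem hc h₂⟩

theorem IsBddElem.mul (hM : IsQuadraticModule M) {f g : A} (hf : IsBddElem M f)
    (hg : IsBddElem M g) : IsBddElem M (f * g) := by
  refine IsBddElem.of_algebraMap_mul hM (c := 4) (by norm_num) ?_
  convert ((hf.add hM hg).sq hM).add hM ((hf.add hM hg.neg).sq hM).neg using 1
  rw [map_ofNat]
  ring

/-- `2(1 ± f) = (1 - f²) + (1 ± f)²`. -/
theorem isBddElem_of_sub_sq_mem (hM : IsQuadraticModule M) {f : A} (h : 1 - f ^ 2 ∈ M) :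
    IsBddElem M f := by
  have h2 : algebraMap ℝ A 2 = 2 := map_ofNat _ 2
  refine ⟨1, one_pos, hM.mem_of_algebraMap_mul_mem two_pos ?_,
    hM.mem_of_algebraMap_mul_mem two_pos ?_⟩
  · convert hM.add_mem h (hM.sq_mul_mem (1 - f) hM.one_mem) using 1
    rw [h2, map_one]
    ring
  · convert hM.add_mem h (hM.sq_mul_mem (1 + f) hM.one_mem) using 1
    rw [h2, map_one]
    ring

theorem isArchimedean_of_isBddElem_X {σ : Type*} {M : Set (MvPolynomial σ ℝ)}
    (hM : IsQuadraticModule M) (h : ∀ i, IsBddElem M (X i)) : IsArchimedean M := by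
  intro f
  suffices IsBddElem M f from let ⟨r, _, hr, _⟩ := this; ⟨r, hr⟩
  induction f using MvPolynomial.induction_on with
  | C a => exact isBddElem_algebraMap hM a
  | add p q hp hq => exact hp.add hM hq
  | mul_X p i hp => exact hp.mul hM (h i)

end IsQuadraticModule

/-! ### Finitely generated quadratic modules -/

/-- The quadratic module generated by a finite family. -/
def quadraticModuleSpan {ι : Type*} [Fintype ι] (g : ι → A) : Set A :=
  {f | ∃ (s₀ : A) (s : ι → A), IsSumSq s₀ ∧ (∀ i, IsSumSq (s i)) ∧ f = s₀ + ∑ i, s i * g i}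

theorem isQuadraticModule_span {ι : Type*} [Fintype ι] (g : ι → A) :
    IsQuadraticModule (quadraticModuleSpan g) where
  one_mem := ⟨1, 0, IsSquare.isSumSq ⟨1, by ring⟩, fun _ => .zero, by simp⟩
  add_mem := by
    rintro _ _ ⟨s₀, s, hs₀, hs, rfl⟩ ⟨t₀, t, ht₀, ht, rfl⟩
    refine ⟨s₀ + t₀, s + t, hs₀.add ht₀, fun i => (hs i).add (ht i), ?_⟩
    simp only [Pi.add_apply, add_mul, Finset.sum_add_distrib]
    ring
  sq_mul_mem := by
    rintro a _ ⟨s₀, s, hs₀, hs, rfl⟩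
    have ha : IsSumSq (a ^ 2) := IsSquare.isSumSq ⟨a, pow_two a⟩
    refine ⟨a ^ 2 * s₀, fun i => a ^ 2 * s i, ha.mul hs₀, fun i => ha.mul (hs i), ?_⟩
    simp only [mul_add, Finset.mul_sum, mul_assoc]

theorem mem_quadraticModuleSpan {ι : Type*} [Fintype ι] (g : ι → A) (i : ι) :
    g i ∈ quadraticModuleSpan g := by
  classical
  refine ⟨0, Pi.single i 1, .zero, fun j => ?_, by simp [Pi.single_apply]⟩
  rcases eq_or_ne j i with rfl | hj
  · rw [Pi.single_eq_same]
    exact IsSquare.isSumSq ⟨1, by ring⟩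
  · rw [Pi.single_eq_of_ne hj]
    exact .zero

/-- A sum of squares is a sum of any sufficiently large number of squares. -/
theorem IsSumSq.exists_forall_ge_eq_sum {a : A} (ha : IsSumSq a) :
    ∃ N : ℕ, ∀ n ≥ N, ∃ r : Fin (n + 1) → A, a = ∑ j, r j ^ 2 := by
  induction ha with
  | zero => exact ⟨0, fun n _ => ⟨0, by simp⟩⟩
  | sq_add a _ ih =>
    obtain ⟨N, hN⟩ := ih
    refine ⟨N + 1, fun n hn => ?_⟩
    obtain ⟨k, rfl⟩ : ∃ k, n = k + 1 := ⟨n - 1, by omega⟩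
    obtain ⟨r, hr⟩ := hN k (by omega)
    exact ⟨Fin.cons a r, by simp [Fin.sum_univ_succ (n := k + 1), hr, pow_two]⟩

theorem exists_eq_sum_sq_of_mem_quadraticModuleSpan {ι : Type*} [Fintype ι] {g : ι → A} {f : A}
    (hf : f ∈ quadraticModuleSpan g) :
    ∃ (N : ℕ) (r : Fin (N + 1) → A) (s : ι → Fin (N + 1) → A),
      f = ∑ j, r j ^ 2 + ∑ i, (∑ j, s i j ^ 2) * g i := by
  obtain ⟨s₀, s, hs₀, hs, rfl⟩ := hf
  obtain ⟨N₀, h₀⟩ := hs₀.exists_forall_ge_eq_sum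
  choose N hN using fun i => (hs i).exists_forall_ge_eq_sum
  -- This length exceeds every individual threshold, so all the sums of squares can share it.
  obtain ⟨r, hr⟩ := h₀ (N₀ + ∑ i, N i) (Nat.le_add_right _ _)
  choose t ht using fun i => hN i (N₀ + ∑ i, N i)
    ((Finset.single_le_sum (fun _ _ => Nat.zero_le _) (Finset.mem_univ i)).trans
      (Nat.le_add_left _ _))
  refine ⟨N₀ + ∑ i, N i, r, t, ?_⟩
  rw [← hr]
  simp only [← ht]

end QuadraticModule

/-! ### The holed disk -/

open IsQuadraticModule in
theorem isArchimedean_of_unitDiskPoly_mem {M : Set (MvPolynomial (Fin 2) ℝ)}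
    (hM : IsQuadraticModule M) (h : unitDiskPoly ∈ M) : IsArchimedean M := by
  refine isArchimedean_of_isBddElem_X hM (Fin.forall_fin_two.2 ⟨?_, ?_⟩) <;>
    refine isBddElem_of_sub_sq_mem hM ?_
  -- Adding the square of the other coordinate to `1 - |x|²` leaves `1 - X i ^ 2`.
  · convert hM.add_mem h (hM.sq_mul_mem (X 1) hM.one_mem) using 1
    rw [unitDiskPoly]
    ring
  · convert hM.add_mem h (hM.sq_mul_mem (X 0) hM.one_mem) using 1
    rw [unitDiskPoly]
    ring

theorem mainTheorem4 (h : ℕ) (c : Fin h → Fin 2 → ℝ) (ρ : Fin h → ℝ)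
    (hS : (nonnegSet (holedDiskPolys c ρ)).Nonempty)
    (p : MvPolynomial (Fin 2) ℝ)
    (hp : ∀ x ∈ nonnegSet (holedDiskPolys c ρ), 0 < eval x p) :
    ∃ (N : ℕ) (r : Fin (N + 1) → MvPolynomial (Fin 2) ℝ)
      (s : Fin (h + 1) → Fin (N + 1) → MvPolynomial (Fin 2) ℝ),
      p = ∑ j, r j ^ 2 + ∑ i, (∑ j, s i j ^ 2) * holedDiskPolys c ρ i := by
  have hM := isQuadraticModule_span (holedDiskPolys c ρ)
  have hmem := mem_quadraticModuleSpan (holedDiskPolys c ρ)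
  refine exists_eq_sum_sq_of_mem_quadraticModuleSpan
    (hM.mem_of_forall_algHom_pos (isArchimedean_of_unitDiskPoly_mem hM (hmem 0)) fun φ hφ => ?_)
  -- A character is evaluation at the point `φ (X i)`, which lies in `S` because `φ` is nonnegative
  -- on the generators.
  have heval (f : MvPolynomial (Fin 2) ℝ) : φ f = eval (fun i => φ (X i)) f := by
    rw [← MvPolynomial.coe_aeval_eq_eval]
    exact DFunLike.congr_fun (MvPolynomial.aeval_unique φ) f
  rw [heval]
  exact hp _ fun i => heval _ ▸ hφ _ (hmem i)
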